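/- Let $\mathcal H$ be a finite-dimensional complex Hilbert space, let $\rho_1,\dots,\rho_r$ be density operators on $\mathcal H$, and let $\eta_1,\dots,\eta_r>0$ with $\sum_i\eta_i=1$. Put $$\operatorname{Err}_n=\inf_{(M_i)}\sum_{i=1}^r\eta_i\operatorname{Tr}[M_i\rho_i^{\otimes n}],$$ where the infimum is over all POVMs $(M_1,\dots,M_r)$ on $\mathcal H^{\otimes n}$, and define the optimal error exponent of antidistinguishability by $$\operatorname{E}(\rho_1,\dots,\rho_r)=\liminf_{n\to\infty}-\tfrac1n\ln\operatorname{Err}_n\in[0,\infty]\qquad(-\ln 0=\infty).$$ For probability measures $P_1,\dots,P_r$ on a finite set $\Omega$, define the multivariate classical Chernoff divergence $$\xi_{\rm cl}(P_1,\dots,P_r)=-\ln\inf_{s}\sum_{\omega\in\Omega}\prod_{i=1}^rP_i(\{\omega\})^{s_i},$$ where $s$ ranges over $\{s\in[0,1]^r:\sum_is_i=1\}$ and $0^0=1$. Define the minimal multivariate quantum Chernoff divergence $$\xi_{\min}(\rho_1,\dots,\rho_r)=\sup_{t,\,(M_x)}\xi_{\rm cl}(P_1^M,\dots,P_r^M),\qquad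 P_i^M(\{x\})=\operatorname{Tr}[M_x\rho_i],$$ where the supremum is over all $t\in\mathbb N$ and POVMs $(M_1,\dots,M_t)$ on $\mathcal H$, and the maximal multivariate quantum Chernoff divergence $$\xi_{\max}(\rho_1,\dots,\rho_r)=\inf_{t,\,\mathcal P,\,(P_i)}\xi_{\rm cl}(P_1,\dots,P_r),$$ where the infimum is over all $t\in\mathbb N$, probability measures $P_1,\dots,P_r$ on $\{1,\dots,t\}$ and quantum channels (completely positive trace-preserving linear maps) $\mathcal P:\mathcal L(\mathbb C^t)\to\mathcal L(\mathcal H)$ such that $\mathcal P\big(\sum_\omega P_i(\{\omega\})|\omega\rangle\langle\omega|\big)=\rho_i$ for all $i$. Then $$\xi_{\min}(\rho_1,\dots,\rho_r)\le\operatorname{E}(\rho_1,\dots,\rho_r)\le\xi_{\max}(\rho_1,\dots,\rho_r).$$ Moreover, $\operatorname{E}(\rho_1^{\otimes\ell},\dots,\rho_r^{\otimes\ell})=\ell\,\operatorname{E}(\rho_1,\dots,\rho_r)$ for every integer $\ell\ge1$, and $$\sup_{\ell\ge1}\tfrac1\ell\,\xi_{\min}(\rho_1^{\otimes\ell},\dots,\rho_r^{\otimes\ell})\le\operatorname{E}(\rho_1,\dots,\rho_r)\le\inf_{\ell\ge1}\tfrac1\ell\,\xi_{\max}(\rho_1^{\otimes\ell},\dots,\rho_r^{\otimes\ell}).$$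 -/

import Mathlib

noncomputable section

namespace AntiDist

open scoped ComplexOrder

/-- A density operator on the Hilbert space `ℂ^d`: positive semidefinite with unit trace. -/
def IsDensity {d : Type*} [Fintype d] (ρ : Matrix d d ℂ) : Prop :=
  ρ.PosSemidef ∧ ρ.trace = 1

/-- A POVM on `ℂ^d` with outcomes in `Fin t`. -/
def IsPOVM {d : Type*} [Fintype d] [DecidableEq d] {t : ℕ}
    (M : Fin t → Matrix d d ℂ) : Prop :=
  (∀ x, (M x).PosSemidef) ∧ ∑ x, M x = 1

/-- The outcome distribution `x ↦ Tr[M_x ρ]` of a measurement. -/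
def outcomeProb {d : Type*} [Fintype d] {t : ℕ}
    (M : Fin t → Matrix d d ℂ) (ρ : Matrix d d ℂ) : Fin t → ℝ :=
  fun x => (M x * ρ).trace.re

/-- The map `id_k ⊗ Φ`, acting on `k × k` block matrices by applying `Φ` to each block. -/
def ampliation {d e : Type*} (k : ℕ) (Φ : Matrix d d ℂ →ₗ[ℂ] Matrix e e ℂ)
    (X : Matrix (Fin k × d) (Fin k × d) ℂ) : Matrix (Fin k × e) (Fin k × e) ℂ :=
  Matrix.of fun p q => Φ (Matrix.of fun i j => X (p.1, i) (q.1, j)) p.2 q.2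

/-- A quantum channel: a completely positive, trace-preserving linear map. -/
def IsChannel {d e : Type*} [Fintype d] [Fintype e]
    (Φ : Matrix d d ℂ →ₗ[ℂ] Matrix e e ℂ) : Prop :=
  (∀ (k : ℕ) (X : Matrix (Fin k × d) (Fin k × d) ℂ),
      X.PosSemidef → (ampliation k Φ X).PosSemidef) ∧
    ∀ X, (Φ X).trace = X.trace

/-- The tensor power `ρ^{⊗ n}` on `(ℂ^d)^{⊗ n} = ℂ^(Fin n → d)`. -/
def tensorPow {d : Type*} (ρ : Matrix d d ℂ) (n : ℕ) : Matrix (Fin n → d) (Fin n → d) ℂ :=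
  Matrix.of fun x y => ∏ k, ρ (x k) (y k)

/-- `-ln x` for `x ≥ 0`, with `-ln 0 = ∞`. -/
def negLog (x : ℝ) : EReal := -ENNReal.log (ENNReal.ofReal x)

/-- Optimal antidistinguishability error probability of the ensemble `{(η_i, ρ_i)}`:
the infimum over all POVMs of `∑ i, η_i Tr[M_i ρ_i]`. -/
def optErr {d : Type*} [Fintype d] [DecidableEq d] {r : ℕ}
    (η : Fin r → ℝ) (ρ : Fin r → Matrix d d ℂ) : ℝ :=
  sInf {e : ℝ | ∃ M : Fin r → Matrix d d ℂ,
    IsPOVM M ∧ e = ∑ i, η i * (M i * ρ i).trace.re}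

/-- Optimal error exponent `liminf_n -(1/n) ln Err({(η_i, ρ_i^{⊗ n})})`, in `[0, ∞]`. -/
def errExponent {d : Type*} [Fintype d] [DecidableEq d] {r : ℕ}
    (η : Fin r → ℝ) (ρ : Fin r → Matrix d d ℂ) : EReal :=
  Filter.liminf
    (fun n : ℕ => negLog (optErr η fun i => tensorPow (ρ i) n) / (n : EReal)) Filter.atTop

/-- Hellinger transform of probability measures on the finite set `Fin t`, given by their
densities with respect to the counting measure (`Real.rpow` has `0 ^ 0 = 1`). -/
def hellinger {r t : ℕ} (P : Fin r → Fin t → ℝ) (s : Fin r → ℝ) : ℝ :=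
  ∑ ω, ∏ i, P i ω ^ s i

/-- Multivariate classical Chernoff divergence `-ln inf_{s ∈ S_r} H_s(P_1, …, P_r)`. -/
def xiCl {r t : ℕ} (P : Fin r → Fin t → ℝ) : EReal :=
  negLog (sInf (hellinger P '' stdSimplex ℝ (Fin r)))

/-- Minimal multivariate quantum Chernoff divergence: the supremum of the classical divergence
of the outcome distributions over all measurements with finitely many outcomes. -/
def xiMin {d : Type*} [Fintype d] [DecidableEq d] {r : ℕ}
    (ρ : Fin r → Matrix d d ℂ) : EReal :=
  sSup {x : EReal | ∃ (t : ℕ) (M : Fin t → Matrix d d ℂ),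
    IsPOVM M ∧ x = xiCl fun i => outcomeProb M (ρ i)}

/-- Maximal multivariate quantum Chernoff divergence: the infimum of the classical divergence
over all probability vectors `P_i` and channels preparing `ρ_i` from the diagonal state `P_i`. -/
def xiMax {d : Type*} [Fintype d] {r : ℕ}
    (ρ : Fin r → Matrix d d ℂ) : EReal :=
  sInf {x : EReal | ∃ (t : ℕ) (Φ : Matrix (Fin t) (Fin t) ℂ →ₗ[ℂ] Matrix d d ℂ)
      (P : Fin r → Fin t → ℝ),
    IsChannel Φ ∧ (∀ i, P i ∈ stdSimplex ℝ (Fin t)) ∧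
      (∀ i, Φ (Matrix.diagonal fun ω => (P i ω : ℂ)) = ρ i) ∧ x = xiCl P}

end AntiDist

end

/-!
The error exponent of antidistinguishability lies between the two Chernoff divergences.

*Lower bound on the exponent.* Measure every copy with the same POVM and announce an index `i`
minimizing `η_i P_i^n(ω)`. The error is `∑_ω min_i η_i P_i^n(ω)`. Since a minimum is at most any
weighted geometric mean, it is at most `H_s(P_1, …, P_r)^n` for every `s` in the simplex
(`optErr_tensorPow_le_hellinger_pow`).

*Upper bound on the exponent.* If a channel prepares `ρ_i` from the diagonal state `P_i`, then
`ρ_i = ∑_ω P_i(ω) σ_ω` with states `σ_ω` not depending on `i`. A POVM on the `n`-fold tensor powers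
therefore yields a randomized classical decision rule for the `P_i^n`, and the claim becomes the
converse of the classical multiple Chernoff bound. Let `m = inf_s H_s > 0`. The optimality
conditions at a minimizing `s` on the common support provide a distribution `Q` with
`D(Q ‖ P_i) ≤ -ln m` for all `i` (`exists_tilted_distribution`). Jensen's inequality under `Q^n`,
with a variance bound on sums of log-likelihood ratios, shows that every rule has error at least
`exp (n ln m - C √n)`, up to the smallest prior (`exists_exp_le_sum_decision`).

*Tensor powers.* The error for `n` copies is antitone in `n`, so the exponent along the multiples of
`ℓ` determines the exponent of the whole sequence (`decayRate_mul`). This gives the scaling relation,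
and the two bounds applied to `ρ_i^{⊗ ℓ}` give the regularized ones.
-/

namespace AntiDist

open scoped ComplexOrder

/-! ### Product operators on tensor powers -/

/-- The operator `A_1 ⊗ ⋯ ⊗ A_n` on `(ℂ^d)^{⊗ n}`, whose index set is `Fin n → d`. -/
def piTensor {d : Type*} {n : ℕ} (A : Fin n → Matrix d d ℂ) :
    Matrix (Fin n → d) (Fin n → d) ℂ :=
  Matrix.of fun x y => ∏ k, A k (x k) (y k)

lemma tensorPow_eq_piTensor {d : Type*} (ρ : Matrix d d ℂ) (n : ℕ) :
    tensorPow ρ n = piTensor fun _ => ρ := rfl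

lemma piTensor_mul {d : Type*} [Fintype d] {n : ℕ} (A B : Fin n → Matrix d d ℂ) :
    piTensor A * piTensor B = piTensor fun k => A k * B k := by
  ext x y
  simp only [piTensor, Matrix.mul_apply, Matrix.of_apply, ← Finset.prod_mul_distrib,
    Finset.prod_univ_sum, Fintype.piFinset_univ]

lemma piTensor_trace {d : Type*} [Fintype d] {n : ℕ} (A : Fin n → Matrix d d ℂ) :
    (piTensor A).trace = ∏ k, (A k).trace := by
  simp only [piTensor, Matrix.trace, Matrix.diag, Matrix.of_apply,
    Finset.prod_univ_sum, Fintype.piFinset_univ]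

lemma piTensor_sum {d Ω : Type*} [Fintype Ω] {n : ℕ} (A : Fin n → Ω → Matrix d d ℂ) :
    piTensor (fun k => ∑ ω, A k ω) = ∑ ω : Fin n → Ω, piTensor fun k => A k (ω k) := by
  ext x y
  simp only [piTensor, Matrix.of_apply, Matrix.sum_apply,
    Finset.prod_univ_sum, Fintype.piFinset_univ]

lemma piTensor_smul {d : Type*} {n : ℕ} (c : Fin n → ℂ) (A : Fin n → Matrix d d ℂ) :
    piTensor (fun k => c k • A k) = (∏ k, c k) • piTensor A := by
  ext x y
  simp [piTensor, Finset.prod_mul_distrib]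

lemma piTensor_one {d : Type*} [DecidableEq d] {n : ℕ} :
    piTensor (fun _ : Fin n => (1 : Matrix d d ℂ)) = 1 := by
  ext x y
  simp only [piTensor, Matrix.of_apply, Matrix.one_apply, funext_iff]
  rw [Finset.prod_ite_zero]
  simp

lemma piTensor_posSemidef {d : Type*} [Fintype d] {n : ℕ} {A : Fin n → Matrix d d ℂ}
    (hA : ∀ k, (A k).PosSemidef) : (piTensor A).PosSemidef := by
  classical
  have h : ∀ k, ∃ B : Matrix d d ℂ, A k = B.conjTranspose * B := fun k => by
    open scoped MatrixOrder in
    obtain ⟨B, hB⟩ := CStarAlgebra.nonneg_iff_eq_star_mul_self.mp (hA k).nonneg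
    exact ⟨B, hB⟩
  choose B hB using h
  have : piTensor A = (piTensor B).conjTranspose * piTensor B := by
    have hc : (piTensor B).conjTranspose = piTensor fun k => (B k).conjTranspose := by
      ext x y
      simp [piTensor, Matrix.conjTranspose_apply]
    rw [hc, piTensor_mul]
    exact congrArg _ (funext hB)
  rw [this]
  exact Matrix.posSemidef_conjTranspose_mul_self _

lemma IsDensity.tensorPow {d : Type*} [Fintype d] {ρ : Matrix d d ℂ} (h : IsDensity ρ) (n : ℕ) :
    IsDensity (tensorPow ρ n) := by
  rw [tensorPow_eq_piTensor]
  exact ⟨piTensor_posSemidef fun _ => h.1, by simp [piTensor_trace, h.2]⟩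

lemma trace_mul_nonneg {d : Type*} [Fintype d] {A B : Matrix d d ℂ}
    (hA : A.PosSemidef) (hB : B.PosSemidef) : 0 ≤ (A * B).trace := by
  classical
  open scoped MatrixOrder in
  obtain ⟨C, hC⟩ := CStarAlgebra.nonneg_iff_eq_star_mul_self.mp hB.nonneg
  have e : (A * B).trace = (C * A * C.conjTranspose).trace := by
    rw [hC, Matrix.mul_assoc C, Matrix.trace_mul_comm C, Matrix.mul_assoc]; rfl
  rw [e]
  exact (hA.mul_mul_conjTranspose_same C).trace_nonneg

lemma trace_mul_re_nonneg {d : Type*} [Fintype d] {A B : Matrix d d ℂ}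
    (hA : A.PosSemidef) (hB : B.PosSemidef) : 0 ≤ (A * B).trace.re :=
  (Complex.nonneg_iff.mp (trace_mul_nonneg hA hB)).1

lemma trace_mul_eq_coe_re {d : Type*} [Fintype d] {A B : Matrix d d ℂ}
    (hA : A.PosSemidef) (hB : B.PosSemidef) : (A * B).trace = ((A * B).trace.re : ℂ) :=
  Complex.ext rfl (by simpa using (Complex.nonneg_iff.mp (trace_mul_nonneg hA hB)).2.symm)

/-! ### Elementary properties of the optimal error -/

section OptErr

variable {d : Type*} [Fintype d] [DecidableEq d] {r : ℕ} {η : Fin r → ℝ}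
  {ρ : Fin r → Matrix d d ℂ}

lemma optErr_le (hη : ∀ i, 0 ≤ η i) (hρ : ∀ i, (ρ i).PosSemidef)
    {M : Fin r → Matrix d d ℂ} (hM : IsPOVM M) :
    optErr η ρ ≤ ∑ i, η i * (M i * ρ i).trace.re := by
  refine csInf_le ⟨0, ?_⟩ ⟨M, hM, rfl⟩
  rintro _ ⟨N, hN, rfl⟩
  exact Finset.sum_nonneg fun i _ => mul_nonneg (hη i) (trace_mul_re_nonneg (hN.1 i) (hρ i))

lemma isPOVM_single (i₀ : Fin r) :
    IsPOVM fun i => if i = i₀ then (1 : Matrix d d ℂ) else 0 := by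
  refine ⟨fun i => ?_, by simp⟩
  dsimp only
  split_ifs
  · exact Matrix.PosSemidef.one
  · exact Matrix.PosSemidef.zero

lemma le_optErr (i₀ : Fin r) {c : ℝ}
    (h : ∀ M : Fin r → Matrix d d ℂ, IsPOVM M → c ≤ ∑ i, η i * (M i * ρ i).trace.re) :
    c ≤ optErr η ρ := by
  refine le_csInf ⟨_, _, isPOVM_single i₀, rfl⟩ ?_
  rintro _ ⟨N, hN, rfl⟩
  exact h N hN

lemma optErr_le_one (hη : ∀ i, 0 ≤ η i) (hη1 : ∑ i, η i = 1) (hρ : ∀ i, IsDensity (ρ i))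
    (i₀ : Fin r) : optErr η ρ ≤ 1 := by
  refine (optErr_le hη (fun i => (hρ i).1) (isPOVM_single i₀)).trans ?_
  have : ∀ i, η i * ((if i = i₀ then (1 : Matrix d d ℂ) else 0) * ρ i).trace.re ≤ η i := by
    intro i
    split_ifs
    · simp [(hρ i).2]
    · simpa using hη i
  exact (Finset.sum_le_sum fun i _ => this i).trans hη1.le

lemma IsPOVM.submatrix {e : Type*} [Fintype e] [DecidableEq e] {M : Fin r → Matrix d d ℂ}
    (hM : IsPOVM M) (f : e ≃ d) : IsPOVM fun i => (M i).submatrix f f := by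
  refine ⟨fun i => (hM.1 i).submatrix f, ?_⟩
  have := congrArg (fun X : Matrix d d ℂ => X.submatrix f f) hM.2
  simp only [Matrix.submatrix_one_equiv] at this
  rw [← this]
  ext x y
  simp [Matrix.sum_apply]

lemma optErr_submatrix_le {e : Type*} [Fintype e] [DecidableEq e] (hη : ∀ i, 0 ≤ η i)
    (hρ : ∀ i, (ρ i).PosSemidef) (i₀ : Fin r) (f : e ≃ d) :
    optErr η (fun i => (ρ i).submatrix f f) ≤ optErr η ρ := by
  refine le_optErr i₀ fun M hM => ?_
  refine (optErr_le hη (fun i => (hρ i).submatrix f) (hM.submatrix f)).trans_eq ?_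
  refine Finset.sum_congr rfl fun i _ => ?_
  rw [Matrix.submatrix_mul_equiv]
  congr 2
  exact Equiv.sum_comp f fun x => (M i * ρ i) x x

lemma optErr_submatrix {e : Type*} [Fintype e] [DecidableEq e] (hη : ∀ i, 0 ≤ η i)
    (hρ : ∀ i, (ρ i).PosSemidef) (i₀ : Fin r) (f : e ≃ d) :
    optErr η (fun i => (ρ i).submatrix f f) = optErr η ρ := by
  refine (optErr_submatrix_le hη hρ i₀ f).antisymm ?_
  simpa using optErr_submatrix_le hη (fun i => (hρ i).submatrix f) i₀ f.symm

open scoped Kronecker in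
/-- An additional subsystem can be ignored by measuring `M_i ⊗ 1`. -/
lemma optErr_kronecker_le {e : Type*} [Fintype e] [DecidableEq e] (hη : ∀ i, 0 ≤ η i)
    (hρ : ∀ i, (ρ i).PosSemidef) {σ : Fin r → Matrix e e ℂ} (hσ : ∀ i, IsDensity (σ i))
    (i₀ : Fin r) : optErr η (fun i => ρ i ⊗ₖ σ i) ≤ optErr η ρ := by
  refine le_optErr i₀ fun M hM => ?_
  have hP : IsPOVM fun i => M i ⊗ₖ (1 : Matrix e e ℂ) := by
    refine ⟨fun i => (hM.1 i).kronecker Matrix.PosSemidef.one, ?_⟩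
    rw [← Matrix.one_kronecker_one, ← hM.2]
    ext x y
    simp [Matrix.sum_apply, Finset.sum_mul]
  refine (optErr_le hη (fun i => (hρ i).kronecker (hσ i).1) hP).trans_eq ?_
  refine Finset.sum_congr rfl fun i _ => ?_
  rw [← Matrix.mul_kronecker_mul, Matrix.trace_kronecker, one_mul, (hσ i).2, mul_one]

end OptErr

section TensorPow

variable {d : Type*} [Fintype d] [DecidableEq d] {r : ℕ} {η : Fin r → ℝ}
  {ρ : Fin r → Matrix d d ℂ}

lemma optErr_tensorPow_antitone (hη : ∀ i, 0 ≤ η i) (hρ : ∀ i, IsDensity (ρ i)) (i₀ : Fin r) :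
    Antitone fun n => optErr η fun i => tensorPow (ρ i) n := by
  refine antitone_nat_of_succ_le fun n => ?_
  refine le_trans (le_of_eq ?_)
    (optErr_kronecker_le hη (fun i => ((hρ i).tensorPow n).1) hρ i₀)
  rw [← optErr_submatrix hη
    (fun i => (((hρ i).tensorPow n).1).kronecker (hρ i).1) i₀
    ((Fin.consEquiv fun _ => d).symm.trans (Equiv.prodComm _ _))]
  congr 1
  ext i x y
  simp [tensorPow, Fin.prod_univ_succ, Fin.consEquiv, Fin.tail, mul_comm]

lemma optErr_tensorPow_tensorPow (hη : ∀ i, 0 ≤ η i) (hρ : ∀ i, IsDensity (ρ i)) (i₀ : Fin r)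
    (ℓ n : ℕ) : optErr η (fun i => tensorPow (tensorPow (ρ i) ℓ) n) =
      optErr η fun i => tensorPow (ρ i) (n * ℓ) := by
  rw [← optErr_submatrix hη (fun i => ((hρ i).tensorPow (n * ℓ)).1) i₀
    ((Equiv.curry (Fin n) (Fin ℓ) d).symm.trans (finProdFinEquiv.arrowCongr (Equiv.refl d)))]
  congr 1
  ext i x y
  simp only [tensorPow, Matrix.of_apply, Matrix.submatrix_apply, ← Fintype.prod_prod_type']
  exact Fintype.prod_equiv finProdFinEquiv _ _ fun p => by simp [Function.uncurry]

end TensorPow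

/-! ### The extended logarithm and error exponents -/

lemma coe_le_negLog_iff {x c : ℝ} : (c : EReal) ≤ negLog x ↔ x ≤ Real.exp (-c) := by
  rw [negLog, EReal.le_neg, ENNReal.log_ofReal]
  split_ifs with h
  · simpa using h.trans (Real.exp_pos _).le
  · rw [← EReal.coe_neg, EReal.coe_le_coe_iff, Real.log_le_iff_le_exp (not_le.mp h)]

lemma negLog_le_coe_iff {x c : ℝ} : negLog x ≤ (c : EReal) ↔ Real.exp (-c) ≤ x := by
  rw [negLog, EReal.neg_le, ENNReal.log_ofReal]
  split_ifs with h
  · have := Real.exp_pos (-c)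
    simpa [← EReal.coe_neg] using h.trans_lt this
  · rw [← EReal.coe_neg, EReal.coe_le_coe_iff, Real.le_log_iff_exp_le (not_le.mp h)]

lemma negLog_sInf_le {S : Set ℝ} (hS : S.Nonempty) {E : EReal}
    (h : ∀ x ∈ S, negLog x ≤ E) : negLog (sInf S) ≤ E := by
  rw [← EReal.le_of_forall_lt_iff_le]
  intro c hc
  rw [negLog_le_coe_iff]
  exact le_csInf hS fun x hx => negLog_le_coe_iff.mp ((h x hx).trans hc.le)

/-- The exponential decay rate `liminf_n -(1/n) ln e_n` of a sequence. -/
noncomputable def decayRate (e : ℕ → ℝ) : EReal :=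
  Filter.liminf (fun n : ℕ => negLog (e n) / (n : EReal)) Filter.atTop

lemma errExponent_eq_decayRate {d : Type*} [Fintype d] [DecidableEq d] {r : ℕ}
    (η : Fin r → ℝ) (ρ : Fin r → Matrix d d ℂ) :
    errExponent η ρ = decayRate fun n => optErr η fun i => tensorPow (ρ i) n := rfl

lemma natCast_pos_ereal {n : ℕ} (hn : 1 ≤ n) : (0 : EReal) < (n : EReal) := by
  exact_mod_cast hn

lemma coe_le_negLog_div_iff {x c : ℝ} {n : ℕ} (hn : 1 ≤ n) :
    (c : EReal) ≤ negLog x / (n : EReal) ↔ x ≤ Real.exp (-(c * n)) := by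
  rw [EReal.le_div_iff_mul_le (natCast_pos_ereal hn) (EReal.natCast_ne_top n),
    ← coe_le_negLog_iff, EReal.coe_mul, EReal.coe_coe_eq_natCast]

lemma negLog_div_le_coe_iff {x c : ℝ} {n : ℕ} (hn : 1 ≤ n) :
    negLog x / (n : EReal) ≤ (c : EReal) ↔ Real.exp (-(c * n)) ≤ x := by
  rw [EReal.div_le_iff_le_mul (natCast_pos_ereal hn) (EReal.natCast_ne_top n),
    ← negLog_le_coe_iff, EReal.coe_mul, EReal.coe_coe_eq_natCast, mul_comm]

lemma coe_le_decayRate {e : ℕ → ℝ} {c : ℝ}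
    (h : ∀ᶠ n : ℕ in Filter.atTop, e n ≤ Real.exp (-(c * n))) : (c : EReal) ≤ decayRate e := by
  refine Filter.le_liminf_of_le (by isBoundedDefault) ?_
  filter_upwards [h, Filter.eventually_ge_atTop 1] with n hn h1
  exact (coe_le_negLog_div_iff h1).mpr hn

lemma decayRate_le_coe {e : ℕ → ℝ} {c : ℝ}
    (h : ∀ᶠ n : ℕ in Filter.atTop, Real.exp (-(c * n)) ≤ e n) : decayRate e ≤ (c : EReal) := by
  refine Filter.liminf_le_of_frequently_le' (Filter.Eventually.frequently ?_)
  filter_upwards [h, Filter.eventually_ge_atTop 1] with n hn h1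
  exact (negLog_div_le_coe_iff h1).mpr hn

lemma eventually_le_exp_of_lt_decayRate {e : ℕ → ℝ} {c : ℝ} (h : (c : EReal) < decayRate e) :
    ∀ᶠ n : ℕ in Filter.atTop, e n ≤ Real.exp (-(c * n)) := by
  filter_upwards [Filter.eventually_lt_of_lt_liminf h, Filter.eventually_ge_atTop 1] with n hn h1
  exact (coe_le_negLog_div_iff h1).mp hn.le

lemma decayRate_nonneg {e : ℕ → ℝ} (h1 : ∀ n, e n ≤ 1) : 0 ≤ decayRate e := by
  rw [← EReal.coe_zero]
  exact coe_le_decayRate (Filter.Eventually.of_forall fun n => by simpa using h1 n)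

/-- Monotonicity makes the decay rate along multiples of `ℓ` govern the whole sequence: `e_m`
is compared with `e_{ℓ ⌊m/ℓ⌋}`, which changes the exponent by a bounded amount only. -/
lemma decayRate_mul {e : ℕ → ℝ} (he : Antitone e) (h1 : ∀ n, e n ≤ 1) {ℓ : ℕ} (hℓ : 1 ≤ ℓ) :
    decayRate (fun n => e (n * ℓ)) = (ℓ : EReal) * decayRate e := by
  have hℓ0 : (0 : ℝ) < ℓ := by exact_mod_cast hℓ
  have hpos := natCast_pos_ereal hℓ
  have hcast (c : ℝ) : (c : EReal) / (ℓ : EReal) = ((c / ℓ : ℝ) : EReal) := by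
    rw [EReal.coe_div, EReal.coe_coe_eq_natCast]
  refine le_antisymm ?_ ?_
  · rw [← EReal.ge_of_forall_gt_iff_ge]
    intro c hc
    rw [← EReal.div_le_iff_le_mul hpos (EReal.natCast_ne_top ℓ), hcast]
    rcases le_or_gt c 0 with hc0 | hc0
    · refine le_trans ?_ (decayRate_nonneg h1)
      exact_mod_cast div_nonpos_of_nonpos_of_nonneg hc0 hℓ0.le
    obtain ⟨b, hb1, hb2⟩ := EReal.lt_iff_exists_real_btwn.mp hc
    rw [EReal.coe_lt_coe_iff] at hb1
    have hb0 : 0 < b := hc0.trans hb1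
    apply coe_le_decayRate
    have hdiv : Filter.Tendsto (fun m : ℕ => m / ℓ) Filter.atTop Filter.atTop :=
      Nat.tendsto_div_const_atTop (by omega)
    have hbig : ∀ᶠ m : ℕ in Filter.atTop, b * ℓ / (b - c) ≤ (m : ℝ) :=
      tendsto_natCast_atTop_atTop.eventually_ge_atTop _
    filter_upwards [hdiv.eventually (eventually_le_exp_of_lt_decayRate hb2), hbig] with m hm hmb
    refine (he (Nat.div_mul_le_self m ℓ)).trans (hm.trans (Real.exp_le_exp.mpr ?_))
    rw [div_le_iff₀ (sub_pos.mpr hb1)] at hmb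
    have hfl : (m : ℝ) ≤ ((m / ℓ : ℕ) : ℝ) * ℓ + ℓ := by
      have : m ≤ m / ℓ * ℓ + ℓ := by
        have := Nat.lt_div_mul_add (a := m) (b := ℓ) (by omega)
        omega
      exact_mod_cast this
    rw [neg_le_neg_iff, div_mul_eq_mul_div, div_le_iff₀ hℓ0]
    nlinarith [mul_le_mul_of_nonneg_left hfl hb0.le]
  · rw [← EReal.ge_of_forall_gt_iff_ge]
    intro c hc
    rw [mul_comm, ← EReal.div_lt_iff hpos (EReal.natCast_ne_top ℓ), hcast] at hc
    apply coe_le_decayRate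
    have hmul : Filter.Tendsto (fun n : ℕ => n * ℓ) Filter.atTop Filter.atTop :=
      Filter.tendsto_id.atTop_mul_const' (by omega)
    filter_upwards [hmul.eventually (eventually_le_exp_of_lt_decayRate hc)] with n hn
    refine hn.trans_eq ?_
    congr 2
    push_cast
    field_simp

/-! ### Achievability: product measurements -/

/-- A minimum is at most every weighted geometric mean. -/
lemma le_prod_rpow_of_forall_le {ι : Type*} [Fintype ι] {s f : ι → ℝ} (hs : s ∈ stdSimplex ℝ ι)
    {m : ℝ} (hm : 0 ≤ m) (h : ∀ i, m ≤ f i) : m ≤ ∏ i, f i ^ s i := by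
  calc m = m ^ ∑ i, s i := by rw [hs.2, Real.rpow_one]
    _ = ∏ i, m ^ s i := Real.rpow_sum_of_nonneg hm fun i _ => hs.1 i
    _ ≤ ∏ i, f i ^ s i := Finset.prod_le_prod (fun i _ => Real.rpow_nonneg hm _)
        fun i _ => Real.rpow_le_rpow hm (h i) (hs.1 i)

lemma hellinger_nonneg {r t : ℕ} {P : Fin r → Fin t → ℝ} (hP : ∀ i ω, 0 ≤ P i ω)
    (s : Fin r → ℝ) : 0 ≤ hellinger P s :=
  Finset.sum_nonneg fun ω _ => Finset.prod_nonneg fun i _ => Real.rpow_nonneg (hP i ω) _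

/-- The Hellinger transform is multiplicative under independent repetition. -/
lemma hellinger_pow {r t : ℕ} {P : Fin r → Fin t → ℝ} (hP : ∀ i ω, 0 ≤ P i ω)
    (s : Fin r → ℝ) (n : ℕ) :
    hellinger P s ^ n = ∑ ω : Fin n → Fin t, ∏ i, (∏ k, P i (ω k)) ^ s i := by
  rw [hellinger, Fintype.sum_pow]
  refine Finset.sum_congr rfl fun ω _ => ?_
  rw [Finset.prod_comm]
  exact Finset.prod_congr rfl fun i _ => Real.finsetProd_rpow _ _ (fun k _ => hP i _) _

section

variable {d : Type*} [Fintype d] [DecidableEq d] {r t : ℕ} {η : Fin r → ℝ}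
  {ρ : Fin r → Matrix d d ℂ}

lemma outcomeProb_nonneg {M : Fin t → Matrix d d ℂ} (hM : IsPOVM M) {σ : Matrix d d ℂ}
    (hσ : σ.PosSemidef) (ω : Fin t) : 0 ≤ outcomeProb M σ ω :=
  trace_mul_re_nonneg (hM.1 ω) hσ

lemma outcomeProb_piTensor {M : Fin t → Matrix d d ℂ} (hM : IsPOVM M) {σ : Matrix d d ℂ}
    (hσ : σ.PosSemidef) {n : ℕ} (ω : Fin n → Fin t) :
    ((piTensor fun k => M (ω k)) * tensorPow σ n).trace.re = ∏ k, outcomeProb M σ (ω k) := by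
  rw [tensorPow_eq_piTensor, piTensor_mul, piTensor_trace,
    Finset.prod_congr rfl fun k _ => trace_mul_eq_coe_re (hM.1 (ω k)) hσ,
    ← Complex.ofReal_prod, Complex.ofReal_re]
  rfl

/-- Measuring each copy with `M` and announcing an index `g ω` that minimizes
`η_i P_i^n(ω)` is a POVM whose error is bounded by any power of the Hellinger transform. -/
lemma optErr_tensorPow_le_hellinger_pow (hη : ∀ i, 0 ≤ η i) (hη1 : ∑ i, η i = 1)
    (hρ : ∀ i, IsDensity (ρ i)) {M : Fin t → Matrix d d ℂ} (hM : IsPOVM M)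
    {s : Fin r → ℝ} (hs : s ∈ stdSimplex ℝ (Fin r)) (i₀ : Fin r) (n : ℕ) :
    optErr η (fun i => tensorPow (ρ i) n) ≤
      hellinger (fun i => outcomeProb M (ρ i)) s ^ n := by
  have hP0 : ∀ i ω, 0 ≤ outcomeProb M (ρ i) ω := fun i => outcomeProb_nonneg hM (hρ i).1
  set p : Fin r → (Fin n → Fin t) → ℝ := fun i ω => ∏ k, outcomeProb M (ρ i) (ω k) with hp
  have hp0 : ∀ i ω, 0 ≤ p i ω := fun i ω => Finset.prod_nonneg fun k _ => hP0 _ _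
  have : Nonempty (Fin r) := ⟨i₀⟩
  choose g hg using fun ω : Fin n → Fin t => Finite.exists_min fun i => η i * p i ω
  have hN : IsPOVM fun i => ∑ ω with g ω = i, piTensor fun k => M (ω k) := by
    refine ⟨fun i => Matrix.posSemidef_sum _ fun ω _ => piTensor_posSemidef fun k => hM.1 _, ?_⟩
    rw [Finset.sum_fiberwise, ← piTensor_sum fun _ => M]
    simp only [hM.2, piTensor_one]
  refine (optErr_le hη (fun i => ((hρ i).tensorPow n).1) hN).trans ?_
  have herr : ∑ i, η i * ((∑ ω with g ω = i, piTensor fun k => M (ω k)) *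
      tensorPow (ρ i) n).trace.re = ∑ ω, η (g ω) * p (g ω) ω := by
    rw [← Finset.sum_fiberwise Finset.univ g]
    refine Finset.sum_congr rfl fun i _ => ?_
    rw [Finset.sum_mul, Matrix.trace_sum, Complex.re_sum, Finset.mul_sum]
    refine Finset.sum_congr rfl fun ω hω => ?_
    rw [outcomeProb_piTensor hM (hρ i).1, (Finset.mem_filter.mp hω).2]
  rw [herr, hellinger_pow hP0]
  refine Finset.sum_le_sum fun ω _ => ?_
  refine (le_prod_rpow_of_forall_le hs (mul_nonneg (hη _) (hp0 _ _)) (hg ω)).trans ?_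
  refine Finset.prod_le_prod (fun i _ => Real.rpow_nonneg (mul_nonneg (hη _) (hp0 _ _)) _)
    fun i _ => Real.rpow_le_rpow (mul_nonneg (hη _) (hp0 _ _)) ?_ (hs.1 i)
  exact mul_le_of_le_one_left (hp0 i ω)
    ((Finset.single_le_sum (fun j _ => hη j) (Finset.mem_univ i)).trans_eq hη1)

lemma negLog_le_decayRate {e : ℕ → ℝ} {x : ℝ} (hx : 0 ≤ x) (h : ∀ n, e n ≤ x ^ n) :
    negLog x ≤ decayRate e := by
  rw [← EReal.ge_of_forall_gt_iff_ge]
  intro c hc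
  refine coe_le_decayRate (Filter.Eventually.of_forall fun n => (h n).trans ?_)
  have := pow_le_pow_left₀ hx (coe_le_negLog_iff.mp hc.le) n
  rwa [← Real.exp_nat_mul, show (n : ℝ) * -c = -(c * n) by ring] at this

theorem xiMin_le_errExponent (hη : ∀ i, 0 ≤ η i) (hη1 : ∑ i, η i = 1)
    (hρ : ∀ i, IsDensity (ρ i)) (i₀ : Fin r) : xiMin ρ ≤ errExponent η ρ := by
  refine sSup_le ?_
  rintro _ ⟨t, M, hM, rfl⟩
  refine negLog_sInf_le (Set.Nonempty.image _ ⟨_, single_mem_stdSimplex ℝ i₀⟩) ?_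
  rintro _ ⟨s, hs, rfl⟩
  exact negLog_le_decayRate
    (hellinger_nonneg (fun i => outcomeProb_nonneg hM (hρ i).1) s)
    fun n => optErr_tensorPow_le_hellinger_pow hη hη1 hρ hM hs i₀ n

end

/-! ### The optimal tilted distribution -/

/-- The Hellinger transform restricted to the common support of the `P_i`. Unlike `hellinger P`,
which may jump at the boundary of the simplex, it is continuous in `s`. -/
noncomputable def suppHellinger {r t : ℕ} (P : Fin r → Fin t → ℝ) (s : Fin r → ℝ) : ℝ :=
  open scoped Classical in
  ∑ ω with ∀ i, 0 < P i ω, Real.exp (∑ i, s i * Real.log (P i ω))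

lemma continuous_suppHellinger {r t : ℕ} (P : Fin r → Fin t → ℝ) :
    Continuous (suppHellinger P) := by
  unfold suppHellinger
  fun_prop

lemma hellinger_eq_suppHellinger {r t : ℕ} {P : Fin r → Fin t → ℝ} (hP : ∀ i ω, 0 ≤ P i ω)
    {s : Fin r → ℝ} (hs : ∀ i, 0 < s i) : hellinger P s = suppHellinger P s := by
  classical
  unfold hellinger suppHellinger
  rw [Finset.sum_filter]
  refine Finset.sum_congr rfl fun ω _ => ?_
  split_ifs with h
  · rw [Real.exp_sum]
    refine Finset.prod_congr rfl fun i _ => ?_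
    rw [Real.rpow_def_of_pos (h i), mul_comm]
  · push Not at h
    obtain ⟨i, hi⟩ := h
    have hi0 : P i ω = 0 := le_antisymm hi (hP i ω)
    exact Finset.prod_eq_zero (Finset.mem_univ i) (by rw [hi0, Real.zero_rpow (hs i).ne'])

/-- Approximating `s` by interior points of the simplex shows that passing to the common
support does not lower the infimum of the Hellinger transform. -/
lemma sInf_hellinger_le_suppHellinger {r t : ℕ} {P : Fin r → Fin t → ℝ} (hP : ∀ i ω, 0 ≤ P i ω)
    (i₀ : Fin r) {s : Fin r → ℝ} (hs : s ∈ stdSimplex ℝ (Fin r)) :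
    sInf (hellinger P '' stdSimplex ℝ (Fin r)) ≤ suppHellinger P s := by
  have hr : (0 : ℝ) < r := by exact_mod_cast i₀.pos
  set u : Fin r → ℝ := fun _ => (r : ℝ)⁻¹ with hu
  have hus : u ∈ stdSimplex ℝ (Fin r) :=
    ⟨fun i => by positivity, by simp [hu, hr.ne']⟩
  have hbdd : BddBelow (hellinger P '' stdSimplex ℝ (Fin r)) := by
    refine ⟨0, ?_⟩
    rintro _ ⟨v, -, rfl⟩
    exact Finset.sum_nonneg fun ω _ => Finset.prod_nonneg fun i _ => Real.rpow_nonneg (hP i ω) _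
  have hcont : Continuous fun ε : ℝ => suppHellinger P ((1 - ε) • s + ε • u) :=
    (continuous_suppHellinger P).comp (by fun_prop)
  have hlim := (hcont.tendsto 0).mono_left (nhdsWithin_le_nhds (s := Set.Ioi 0))
  simp only [sub_zero, one_smul, zero_smul, add_zero] at hlim
  refine ge_of_tendsto hlim ?_
  filter_upwards [Ioo_mem_nhdsGT (zero_lt_one' ℝ)] with ε hε
  have hpos : ∀ i, 0 < ((1 - ε) • s + ε • u) i := fun i => by
    have h1 := mul_nonneg (sub_nonneg.mpr hε.2.le) (hs.1 i)
    have h2 : 0 < ε * (r : ℝ)⁻¹ := mul_pos hε.1 (inv_pos.mpr hr)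
    simp only [Pi.add_apply, Pi.smul_apply, smul_eq_mul, hu]
    linarith
  rw [← hellinger_eq_suppHellinger hP hpos]
  refine csInf_le hbdd ⟨_, ?_, rfl⟩
  exact convex_stdSimplex ℝ (Fin r) hs hus (sub_nonneg.mpr hε.2.le) hε.1.le (by ring)

/-- First-order optimality at a minimizer of `∑ ω, exp (A_ω + τ B_ω)` over `τ ≥ 0`. -/
lemma sum_exp_mul_nonneg_of_forall_le {ι : Type*} {F : Finset ι} {A B : ι → ℝ}
    (h : ∀ τ : ℝ, 0 < τ → τ < 1 →
      ∑ ω ∈ F, Real.exp (A ω) ≤ ∑ ω ∈ F, Real.exp (A ω + τ * B ω)) :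
    0 ≤ ∑ ω ∈ F, Real.exp (A ω) * B ω := by
  have hd : HasDerivAt (fun τ : ℝ => ∑ ω ∈ F, Real.exp (A ω + τ * B ω))
      (∑ ω ∈ F, Real.exp (A ω) * B ω) 0 := by
    refine HasDerivAt.fun_sum fun ω _ => ?_
    have := (((hasDerivAt_id (0 : ℝ)).mul_const (B ω)).const_add (A ω)).exp
    simpa using this
  refine ge_of_tendsto hd.tendsto_slope_zero_right ?_
  filter_upwards [Ioo_mem_nhdsGT (zero_lt_one' ℝ)] with τ hτ
  have := h τ hτ.1 hτ.2
  simp only [zero_add, zero_mul, add_zero, smul_eq_mul]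
  exact mul_nonneg (inv_nonneg.mpr hτ.1.le) (sub_nonneg.mpr this)

/-- If `m = inf_s H_s > 0`, there is a distribution `Q` with relative entropies
`D(Q ‖ P_i) ≤ -ln m` for all `i` at once. Here `a i` is the log-likelihood ratio `ln (P_i / Q)`
on the support of `Q`. The distribution is the normalized geometric mean `∏ P_i^{s_i}` at a
minimizer `s`, and the bounds are the optimality conditions in the directions of the vertices. -/
lemma exists_tilted_distribution {r t : ℕ} {P : Fin r → Fin t → ℝ} (hP : ∀ i ω, 0 ≤ P i ω)
    (i₀ : Fin r) (hm : 0 < sInf (hellinger P '' stdSimplex ℝ (Fin r))) :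
    ∃ (Q : Fin t → ℝ) (a : Fin r → Fin t → ℝ), Q ∈ stdSimplex ℝ (Fin t) ∧
      (∀ i ω, Q ω * Real.exp (a i ω) ≤ P i ω) ∧
      ∀ i, Real.log (sInf (hellinger P '' stdSimplex ℝ (Fin r))) ≤ ∑ ω, Q ω * a i ω := by
  classical
  obtain ⟨s, hs, hmin⟩ := (isCompact_stdSimplex ℝ (Fin r)).exists_isMinOn
    ⟨_, single_mem_stdSimplex ℝ i₀⟩ (continuous_suppHellinger P).continuousOn
  set m := sInf (hellinger P '' stdSimplex ℝ (Fin r)) with hm_def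
  set Z := suppHellinger P s with hZ_def
  have hmZ : m ≤ Z := sInf_hellinger_le_suppHellinger hP i₀ hs
  have hZ : 0 < Z := hm.trans_le hmZ
  set F : Finset (Fin t) := {ω | ∀ i, 0 < P i ω} with hF
  set A : Fin t → ℝ := fun ω => ∑ i, s i * Real.log (P i ω) with hA
  have hZA : Z = ∑ ω ∈ F, Real.exp (A ω) := by
    rw [hZ_def, suppHellinger, hF]
  set Q : Fin t → ℝ := fun ω => if ω ∈ F then Real.exp (A ω) / Z else 0 with hQ
  have hQsum (f : Fin t → ℝ) : ∑ ω, Q ω * f ω = (∑ ω ∈ F, Real.exp (A ω) * f ω) / Z := by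
    simp only [hQ, ite_mul, zero_mul]
    rw [← Finset.sum_filter, Finset.filter_univ_mem, Finset.sum_div]
    exact Finset.sum_congr rfl fun ω _ => by ring
  have hQ1 : ∑ ω, Q ω = 1 := by
    have := hQsum fun _ => 1
    simp only [mul_one, ← hZA] at this
    rw [this, div_self hZ.ne']
  refine ⟨Q, fun i ω => Real.log (P i ω) - A ω + Real.log Z, ⟨fun ω => ?_, hQ1⟩,
    fun i ω => ?_, fun i => ?_⟩
  · simp only [hQ]
    split_ifs <;> positivity
  · by_cases h : ω ∈ F
    · have hi : 0 < P i ω := (Finset.mem_filter.mp h).2 i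
      simp only [hQ, if_pos h]
      rw [Real.exp_add, Real.exp_sub, Real.exp_log hi, Real.exp_log hZ]
      have := Real.exp_pos (A ω)
      apply le_of_eq
      field_simp
    · simpa [hQ, h] using hP i ω
  · have hopt : 0 ≤ ∑ ω ∈ F, Real.exp (A ω) * (Real.log (P i ω) - A ω) := by
      refine sum_exp_mul_nonneg_of_forall_le fun τ h0 h1 => ?_
      have hmem : (1 - τ) • s + τ • Pi.single i (1 : ℝ) ∈ stdSimplex ℝ (Fin r) :=
        convex_stdSimplex ℝ (Fin r) hs (single_mem_stdSimplex ℝ i)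
          (sub_nonneg.mpr h1.le) h0.le (by ring)
      have hle : Z ≤ _ := hmin hmem
      rw [← hZA]
      refine hle.trans_eq ?_
      rw [suppHellinger, ← hF]
      refine Finset.sum_congr rfl fun ω _ => ?_
      congr 1
      simp only [Pi.add_apply, Pi.smul_apply, smul_eq_mul, add_mul, Finset.sum_add_distrib,
        mul_assoc, ← Finset.mul_sum, Pi.single_apply, ite_mul, one_mul, zero_mul,
        Finset.sum_ite_eq', Finset.mem_univ, if_true]
      ring
    have hsplit : ∑ ω, Q ω * (Real.log (P i ω) - A ω + Real.log Z) =
        ∑ ω, Q ω * (Real.log (P i ω) - A ω) + Real.log Z := by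
      simp only [mul_add, Finset.sum_add_distrib, ← Finset.sum_mul, hQ1, one_mul]
    rw [hsplit, hQsum]
    have := div_nonneg hopt hZ.le
    have := Real.log_le_log hm hmZ
    linarith

/-! ### A one-shot lower bound for classical product distributions -/

section Moments

variable {t : ℕ} {Q : Fin t → ℝ}

lemma prod_mem_stdSimplex (hQ : Q ∈ stdSimplex ℝ (Fin t)) (n : ℕ) :
    (fun ω : Fin n → Fin t => ∏ k, Q (ω k)) ∈ stdSimplex ℝ (Fin n → Fin t) :=
  ⟨fun ω => Finset.prod_nonneg fun k _ => hQ.1 _, by rw [← Fintype.sum_pow, hQ.2, one_pow]⟩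

lemma sum_fin_succ_fun {n : ℕ} (f : (Fin (n + 1) → Fin t) → ℝ) :
    ∑ ω, f ω = ∑ x, ∑ ω : Fin n → Fin t, f (Fin.cons x ω) := by
  rw [← Fintype.sum_prod_type']
  exact ((Fin.consEquiv fun _ => Fin t).sum_comp f).symm

/-- Centred sums have mean zero under a product distribution. -/
lemma sum_prod_mul_sum_eq_zero (hQ : Q ∈ stdSimplex ℝ (Fin t)) {b : Fin t → ℝ}
    (hb : ∑ x, Q x * b x = 0) (n : ℕ) :
    ∑ ω : Fin n → Fin t, (∏ k, Q (ω k)) * ∑ k, b (ω k) = 0 := by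
  induction n with
  | zero => simp
  | succ n ih =>
    have hn := (prod_mem_stdSimplex hQ n).2
    rw [sum_fin_succ_fun]
    simp only [Fin.prod_univ_succ, Fin.sum_univ_succ, Fin.cons_zero, Fin.cons_succ]
    have key : ∀ x, ∑ ω : Fin n → Fin t, (Q x * ∏ k, Q (ω k)) * (b x + ∑ k, b (ω k)) =
        Q x * b x := fun x => by
      calc _ = Q x * b x * ∑ ω : Fin n → Fin t, ∏ k, Q (ω k) +
            Q x * ∑ ω : Fin n → Fin t, (∏ k, Q (ω k)) * ∑ k, b (ω k) := by
            rw [Finset.mul_sum, Finset.mul_sum, ← Finset.sum_add_distrib]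
            exact Finset.sum_congr rfl fun ω _ => by ring
        _ = _ := by rw [hn, ih]; ring
    rw [Finset.sum_congr rfl fun x _ => key x, hb]

/-- Variances of centred sums add up under a product distribution. -/
lemma sum_prod_mul_sum_sq (hQ : Q ∈ stdSimplex ℝ (Fin t)) {b : Fin t → ℝ}
    (hb : ∑ x, Q x * b x = 0) (n : ℕ) :
    ∑ ω : Fin n → Fin t, (∏ k, Q (ω k)) * (∑ k, b (ω k)) ^ 2 =
      n * ∑ x, Q x * b x ^ 2 := by
  induction n with
  | zero => simp
  | succ n ih =>
    have hn := (prod_mem_stdSimplex hQ n).2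
    rw [sum_fin_succ_fun]
    simp only [Fin.prod_univ_succ, Fin.sum_univ_succ, Fin.cons_zero, Fin.cons_succ]
    have key : ∀ x, ∑ ω : Fin n → Fin t, (Q x * ∏ k, Q (ω k)) * (b x + ∑ k, b (ω k)) ^ 2 =
        Q x * b x ^ 2 + Q x * (n * ∑ x, Q x * b x ^ 2) := fun x => by
      calc _ = Q x * b x ^ 2 * ∑ ω : Fin n → Fin t, ∏ k, Q (ω k) +
            2 * Q x * b x * ∑ ω : Fin n → Fin t, (∏ k, Q (ω k)) * ∑ k, b (ω k) +
            Q x * ∑ ω : Fin n → Fin t, (∏ k, Q (ω k)) * (∑ k, b (ω k)) ^ 2 := by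
            rw [Finset.mul_sum, Finset.mul_sum, Finset.mul_sum, ← Finset.sum_add_distrib,
              ← Finset.sum_add_distrib]
            exact Finset.sum_congr rfl fun ω _ => by ring
        _ = _ := by rw [hn, ih, sum_prod_mul_sum_eq_zero hQ hb]; ring
    rw [Finset.sum_congr rfl fun x _ => key x, Finset.sum_add_distrib, ← Finset.sum_mul, hQ.2]
    push_cast
    ring

/-- The mean absolute value of a centred sum is of order `√n`. -/
lemma sum_prod_mul_abs_sum_le (hQ : Q ∈ stdSimplex ℝ (Fin t)) {b : Fin t → ℝ}
    (hb : ∑ x, Q x * b x = 0) (n : ℕ) :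
    ∑ ω : Fin n → Fin t, (∏ k, Q (ω k)) * |∑ k, b (ω k)| ≤
      √n * ((∑ x, Q x * b x ^ 2 + 1) / 2) := by
  rcases Nat.eq_zero_or_pos n with rfl | hn
  · simp
  have hc : 0 < √(n : ℝ) := Real.sqrt_pos.mpr (by exact_mod_cast hn)
  have hsq : √(n : ℝ) * √n = n := Real.mul_self_sqrt n.cast_nonneg
  have habs (T : ℝ) : |T| ≤ T ^ 2 / (2 * √n) + √n / 2 := by
    have : T ^ 2 / (2 * √n) + √n / 2 - |T| = (|T| - √n) ^ 2 / (2 * √n) := by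
      rw [← sq_abs T]
      field_simp
      ring
    have : 0 ≤ (|T| - √n) ^ 2 / (2 * √n) := by positivity
    linarith
  have hQn := prod_mem_stdSimplex hQ n
  calc _ ≤ ∑ ω : Fin n → Fin t,
        (∏ k, Q (ω k)) * ((∑ k, b (ω k)) ^ 2 / (2 * √n) + √n / 2) :=
        Finset.sum_le_sum fun ω _ => mul_le_mul_of_nonneg_left (habs _) (hQn.1 ω)
    _ = (∑ ω : Fin n → Fin t, (∏ k, Q (ω k)) * (∑ k, b (ω k)) ^ 2) / (2 * √n) +
        (∑ ω : Fin n → Fin t, ∏ k, Q (ω k)) * (√n / 2) := by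
        rw [Finset.sum_div, Finset.sum_mul, ← Finset.sum_add_distrib]
        exact Finset.sum_congr rfl fun ω _ => by ring
    _ = _ := by
        rw [sum_prod_mul_sum_sq hQ hb, hQn.2]
        nth_rewrite 1 [← hsq]
        field_simp

end Moments

/-- Any randomized decision rule `w` has total error at least `exp (n h - C √n)` when some `Q`
satisfies `P_i ≥ Q e^{a_i}` with `E_Q a_i ≥ h` for all `i`. By Jensen's inequality under `Q^n`, the
exponent is at least the mean of the chosen log-likelihood ratio sum, whose fluctuations are
of order `√n` uniformly in the rule. -/
lemma exists_exp_le_sum_decision {r t : ℕ} {P : Fin r → Fin t → ℝ} {Q : Fin t → ℝ}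
    {a : Fin r → Fin t → ℝ} {h : ℝ} (hQ : Q ∈ stdSimplex ℝ (Fin t))
    (hPQ : ∀ i ω, Q ω * Real.exp (a i ω) ≤ P i ω) (ha : ∀ i, h ≤ ∑ ω, Q ω * a i ω) :
    ∃ C : ℝ, ∀ (n : ℕ) (w : Fin r → (Fin n → Fin t) → ℝ), (∀ i ω, 0 ≤ w i ω) →
      (∀ ω, ∑ i, w i ω = 1) →
      Real.exp (n * h - C * √n) ≤ ∑ ω, ∑ i, w i ω * ∏ k, P i (ω k) := by
  set e : Fin r → ℝ := fun i => ∑ ω, Q ω * a i ω with he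
  set b : Fin r → Fin t → ℝ := fun i ω => a i ω - e i with hb_def
  have hb (i : Fin r) : ∑ ω, Q ω * b i ω = 0 := by
    simp only [hb_def, mul_sub, Finset.sum_sub_distrib, ← Finset.sum_mul, hQ.2, one_mul, he,
      sub_self]
  refine ⟨∑ i, (∑ ω, Q ω * b i ω ^ 2 + 1) / 2, fun n w hw hw1 => ?_⟩
  set q : (Fin n → Fin t) → ℝ := fun ω => ∏ k, Q (ω k) with hq
  have hqS : q ∈ stdSimplex ℝ (Fin n → Fin t) := prod_mem_stdSimplex hQ n
  set S : Fin r → (Fin n → Fin t) → ℝ := fun i ω => ∑ k, a i (ω k) with hS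
  have hSb (i : Fin r) (ω : Fin n → Fin t) : n * h - ∑ j, |∑ k, b j (ω k)| ≤ S i ω := by
    have h1 : S i ω = n * e i + ∑ k, b i (ω k) := by
      simp [hS, hb_def]
    have h2 : |∑ k, b i (ω k)| ≤ ∑ j, |∑ k, b j (ω k)| :=
      Finset.single_le_sum (f := fun j => |∑ k, b j (ω k)|)
        (fun j _ => abs_nonneg _) (Finset.mem_univ i)
    have h3 := neg_abs_le (∑ k, b i (ω k))
    have h4 := mul_le_mul_of_nonneg_left (ha i) (Nat.cast_nonneg (α := ℝ) n)
    rw [h1]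
    linarith
  have hpt (i : Fin r) (ω : Fin n → Fin t) : q ω * Real.exp (S i ω) ≤ ∏ k, P i (ω k) := by
    rw [hq, hS, Real.exp_sum, ← Finset.prod_mul_distrib]
    exact Finset.prod_le_prod (fun k _ => mul_nonneg (hQ.1 _) (Real.exp_pos _).le)
      fun k _ => hPQ i _
  have hfluct : n * h - (∑ i, (∑ ω, Q ω * b i ω ^ 2 + 1) / 2) * √n ≤
      ∑ ω, q ω * (n * h - ∑ j, |∑ k, b j (ω k)|) := by
    have h1 : ∑ ω, q ω * (n * h - ∑ j, |∑ k, b j (ω k)|) =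
        n * h - ∑ j, ∑ ω, q ω * |∑ k, b j (ω k)| := by
      rw [Finset.sum_comm]
      simp only [mul_sub, Finset.sum_sub_distrib, ← Finset.sum_mul, hqS.2, one_mul,
        Finset.mul_sum]
    rw [h1, Finset.sum_mul]
    refine sub_le_sub_left (Finset.sum_le_sum fun j _ => ?_) _
    rw [mul_comm]
    exact sum_prod_mul_abs_sum_le hQ (hb j) n
  calc Real.exp (n * h - (∑ i, (∑ ω, Q ω * b i ω ^ 2 + 1) / 2) * √n)
      ≤ Real.exp (∑ ω, q ω * (n * h - ∑ j, |∑ k, b j (ω k)|)) := Real.exp_le_exp.mpr hfluct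
    _ ≤ ∑ ω, q ω * Real.exp (n * h - ∑ j, |∑ k, b j (ω k)|) :=
        convexOn_exp.map_sum_le (fun ω _ => hqS.1 ω) hqS.2 fun ω _ => Set.mem_univ _
    _ ≤ _ := ?_
  refine Finset.sum_le_sum fun ω _ => ?_
  calc q ω * Real.exp (n * h - ∑ j, |∑ k, b j (ω k)|)
      = ∑ i, w i ω * (q ω * Real.exp (n * h - ∑ j, |∑ k, b j (ω k)|)) := by
        rw [← Finset.sum_mul, hw1, one_mul]
    _ ≤ _ := Finset.sum_le_sum fun i _ => mul_le_mul_of_nonneg_left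
        ((mul_le_mul_of_nonneg_left (Real.exp_le_exp.mpr (hSb i ω)) (hqS.1 ω)).trans (hpt i ω))
        (hw i ω)

/-! ### Optimality: states prepared from classical distributions -/

lemma IsChannel.map_posSemidef {d e : Type*} [Fintype d] [Fintype e]
    {Φ : Matrix d d ℂ →ₗ[ℂ] Matrix e e ℂ} (hΦ : IsChannel Φ) {X : Matrix d d ℂ}
    (hX : X.PosSemidef) : (Φ X).PosSemidef :=
  (hΦ.1 1 (X.submatrix Prod.snd Prod.snd) (hX.submatrix _)).submatrix fun i => (0, i)

lemma IsChannel.isDensity_map_single {d : Type*} [Fintype d] {t : ℕ}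
    {Φ : Matrix (Fin t) (Fin t) ℂ →ₗ[ℂ] Matrix d d ℂ} (hΦ : IsChannel Φ) (ω : Fin t) :
    IsDensity (Φ (Matrix.single ω ω 1)) := by
  refine ⟨hΦ.map_posSemidef ?_, by rw [hΦ.2, Matrix.trace_single_eq_same]⟩
  rw [← Matrix.diagonal_single]
  refine Matrix.PosSemidef.diagonal fun i => ?_
  by_cases h : i = ω
  · subst h; simp
  · simp [h]

lemma map_diagonal_eq_sum {d : Type*} {t : ℕ}
    (Φ : Matrix (Fin t) (Fin t) ℂ →ₗ[ℂ] Matrix d d ℂ) (p : Fin t → ℝ) :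
    Φ (Matrix.diagonal fun ω => (p ω : ℂ)) = ∑ ω, (p ω : ℂ) • Φ (Matrix.single ω ω 1) := by
  simp only [← map_smul, ← map_sum]
  congr 1
  ext i j
  simp only [Matrix.sum_apply, Matrix.smul_apply, Matrix.single_apply, Matrix.diagonal_apply,
    smul_eq_mul, mul_ite, mul_one, mul_zero]
  by_cases h : i = j
  · subst h; simp
  · rw [if_neg h, eq_comm]
    exact Finset.sum_eq_zero fun ω _ => if_neg fun hω => h (hω.1.symm.trans hω.2)

section

variable {d : Type*} {t n : ℕ}

lemma tensorPow_sum_smul (p : Fin t → ℝ) (σ : Fin t → Matrix d d ℂ) :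
    tensorPow (∑ ω, (p ω : ℂ) • σ ω) n =
      ∑ ω : Fin n → Fin t, ((∏ k, p (ω k) : ℝ) : ℂ) • piTensor fun k => σ (ω k) := by
  rw [tensorPow_eq_piTensor, piTensor_sum fun _ ω => (p ω : ℂ) • σ ω]
  refine Finset.sum_congr rfl fun ω _ => ?_
  rw [piTensor_smul, Complex.ofReal_prod]

variable [Fintype d] [DecidableEq d] {r : ℕ} {η : Fin r → ℝ}

/-- If all `ρ_i = ∑_ω P_i(ω) σ_ω` are mixtures of the same states, then a POVM on
`ρ_1^{⊗ n}, …, ρ_r^{⊗ n}` induces a randomized decision rule for the `P_i^n`, so the bound for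
classical decision rules applies. -/
lemma exists_exp_le_optErr_of_mixture {P : Fin r → Fin t → ℝ} {σ : Fin t → Matrix d d ℂ}
    (hσ : ∀ ω, IsDensity (σ ω)) (hP : ∀ i ω, 0 ≤ P i ω) (hη : ∀ i, 0 < η i) (i₀ : Fin r)
    (hm : 0 < sInf (hellinger P '' stdSimplex ℝ (Fin r))) :
    ∃ C c : ℝ, 0 < c ∧ ∀ n : ℕ,
      c * Real.exp (n * Real.log (sInf (hellinger P '' stdSimplex ℝ (Fin r))) - C * √n) ≤
        optErr η fun i => tensorPow (∑ ω, (P i ω : ℂ) • σ ω) n := by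
  obtain ⟨Q, a, hQ, hPQ, ha⟩ := exists_tilted_distribution hP i₀ hm
  obtain ⟨C, hC⟩ := exists_exp_le_sum_decision hQ hPQ ha
  have : Nonempty (Fin r) := ⟨i₀⟩
  obtain ⟨j, hj⟩ := Finite.exists_min η
  refine ⟨C, η j, hη j, fun n => le_optErr i₀ fun M hM => ?_⟩
  have hσn (ω : Fin n → Fin t) : (piTensor fun k => σ (ω k)).PosSemidef :=
    piTensor_posSemidef fun k => (hσ _).1
  set w : Fin r → (Fin n → Fin t) → ℝ :=
    fun i ω => (M i * piTensor fun k => σ (ω k)).trace.re with hw_def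
  have hw : ∀ i ω, 0 ≤ w i ω := fun i ω => trace_mul_re_nonneg (hM.1 i) (hσn ω)
  have hw1 (ω : Fin n → Fin t) : ∑ i, w i ω = 1 := by
    rw [hw_def, ← Complex.re_sum, ← Matrix.trace_sum, ← Finset.sum_mul, hM.2, one_mul,
      piTensor_trace]
    simp [(hσ _).2]
  have hterm (i : Fin r) : (M i * tensorPow (∑ ω, (P i ω : ℂ) • σ ω) n).trace.re =
      ∑ ω, w i ω * ∏ k, P i (ω k) := by
    rw [tensorPow_sum_smul, Finset.mul_sum, Matrix.trace_sum, Complex.re_sum]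
    refine Finset.sum_congr rfl fun ω _ => ?_
    rw [Matrix.mul_smul, Matrix.trace_smul, smul_eq_mul, Complex.re_ofReal_mul, mul_comm]
  have hsum : ∀ i, 0 ≤ ∑ ω, w i ω * ∏ k, P i (ω k) := fun i =>
    Finset.sum_nonneg fun ω _ => mul_nonneg (hw i ω) (Finset.prod_nonneg fun k _ => hP _ _)
  calc _ ≤ η j * ∑ ω, ∑ i, w i ω * ∏ k, P i (ω k) :=
        mul_le_mul_of_nonneg_left (hC n w hw hw1) (hη j).le
    _ = ∑ i, η j * ∑ ω, w i ω * ∏ k, P i (ω k) := by rw [Finset.sum_comm, Finset.mul_sum]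
    _ ≤ ∑ i, η i * ∑ ω, w i ω * ∏ k, P i (ω k) :=
        Finset.sum_le_sum fun i _ => mul_le_mul_of_nonneg_right (hj i) (hsum i)
    _ = _ := Finset.sum_congr rfl fun i _ => by rw [hterm]

end

/-- Subexponential prefactors do not affect the decay rate. -/
lemma decayRate_le_negLog {e : ℕ → ℝ} {m C c : ℝ} (hm : 0 < m) (hc : 0 < c)
    (h : ∀ n : ℕ, c * Real.exp (n * Real.log m - C * √n) ≤ e n) : decayRate e ≤ negLog m := by
  rw [← EReal.le_of_forall_lt_iff_le]
  intro x hx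
  have hx' : -Real.log m < x := by
    rwa [negLog, ENNReal.log_ofReal, if_neg (not_le.mpr hm), ← EReal.coe_neg,
      EReal.coe_lt_coe_iff] at hx
  refine decayRate_le_coe ?_
  set δ := x + Real.log m with hδ_def
  have hδ : 0 < δ := by linarith
  have hsqrt : Filter.Tendsto (fun n : ℕ => √(n : ℝ)) Filter.atTop Filter.atTop :=
    Real.tendsto_sqrt_atTop.comp tendsto_natCast_atTop_atTop
  filter_upwards [hsqrt.eventually_ge_atTop ((C + |Real.log c|) / δ),
    Filter.eventually_ge_atTop 1] with n hn hn1
  refine le_trans ?_ (h n)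
  rw [← Real.exp_log hc, ← Real.exp_add, Real.exp_le_exp]
  have h1 : (1 : ℝ) ≤ √n := Real.one_le_sqrt.mpr (by exact_mod_cast hn1)
  have hsq : √(n : ℝ) * √n = n := Real.mul_self_sqrt n.cast_nonneg
  rw [div_le_iff₀ hδ] at hn
  have h2 := mul_le_mul_of_nonneg_left hn (zero_le_one.trans h1)
  have h3 := mul_le_mul_of_nonneg_right h1 (abs_nonneg (Real.log c))
  have h4 := neg_abs_le (Real.log c)
  have h5 : √(n : ℝ) * (√n * δ) = x * n + n * Real.log m := by
    rw [← mul_assoc, hsq, hδ_def]; ring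
  linarith

section

variable {d : Type*} [Fintype d] [DecidableEq d] {r : ℕ} {η : Fin r → ℝ}
  {ρ : Fin r → Matrix d d ℂ}

theorem errExponent_le_xiMax (hη : ∀ i, 0 < η i) (i₀ : Fin r) :
    errExponent η ρ ≤ xiMax ρ := by
  refine le_sInf ?_
  rintro _ ⟨t, Φ, P, hΦ, hP, hΦP, rfl⟩
  rw [xiCl, errExponent_eq_decayRate]
  -- If the infimum vanishes, for instance when the `P_i` have no common support point, then
  -- `xiCl P = ⊤` and there is nothing to prove.
  rcases le_or_gt (sInf (hellinger P '' stdSimplex ℝ (Fin r))) 0 with hm | hm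
  · have htop : negLog (sInf (hellinger P '' stdSimplex ℝ (Fin r))) = ⊤ := by
      rw [negLog, ENNReal.log_ofReal, if_pos hm, EReal.neg_bot]
    rw [htop]
    exact le_top
  obtain ⟨C, c, hc, h⟩ := exists_exp_le_optErr_of_mixture hΦ.isDensity_map_single
    (fun i => (hP i).1) hη i₀ hm
  simp only [← map_diagonal_eq_sum, hΦP] at h
  exact decayRate_le_negLog hm hc h

/-! ### Tensor powers and regularization -/

theorem errExponent_tensorPow (hη : ∀ i, 0 ≤ η i) (hη1 : ∑ i, η i = 1)
    (hρ : ∀ i, IsDensity (ρ i)) (i₀ : Fin r) {ℓ : ℕ} (hℓ : 1 ≤ ℓ) :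
    errExponent η (fun i => tensorPow (ρ i) ℓ) = (ℓ : EReal) * errExponent η ρ := by
  simp only [errExponent_eq_decayRate, optErr_tensorPow_tensorPow hη hρ i₀]
  exact decayRate_mul (optErr_tensorPow_antitone hη hρ i₀)
    (fun n => optErr_le_one hη hη1 (fun i => (hρ i).tensorPow n) i₀) hℓ

end

end AntiDist

theorem mainTheorem4 {d : Type*} [Fintype d] [DecidableEq d] {r : ℕ}
    (η : Fin r → ℝ) (hη : ∀ i, 0 < η i) (hη1 : ∑ i, η i = 1)
    (ρ : Fin r → Matrix d d ℂ) (hρ : ∀ i, AntiDist.IsDensity (ρ i)) :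
    (AntiDist.xiMin ρ ≤ AntiDist.errExponent η ρ ∧
      AntiDist.errExponent η ρ ≤ AntiDist.xiMax ρ) ∧
    (∀ ℓ : ℕ, 1 ≤ ℓ →
      AntiDist.errExponent η (fun i => AntiDist.tensorPow (ρ i) ℓ) =
        (ℓ : EReal) * AntiDist.errExponent η ρ) ∧
    (⨆ ℓ : ℕ, ⨆ _ : 1 ≤ ℓ,
        AntiDist.xiMin (fun i => AntiDist.tensorPow (ρ i) ℓ) / (ℓ : EReal)) ≤
      AntiDist.errExponent η ρ ∧
    AntiDist.errExponent η ρ ≤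
      ⨅ ℓ : ℕ, ⨅ _ : 1 ≤ ℓ,
        AntiDist.xiMax (fun i => AntiDist.tensorPow (ρ i) ℓ) / (ℓ : EReal) := by
  have hη0 : ∀ i, 0 ≤ η i := fun i => (hη i).le
  -- The priors sum to one, so there is at least one state.
  obtain ⟨i₀⟩ : Nonempty (Fin r) := by
    by_contra h
    rw [not_nonempty_iff] at h
    simp at hη1
  have hscale := fun (ℓ : ℕ) (hℓ : 1 ≤ ℓ) =>
    AntiDist.errExponent_tensorPow hη0 hη1 hρ i₀ hℓ
  refine ⟨⟨AntiDist.xiMin_le_errExponent hη0 hη1 hρ i₀, AntiDist.errExponent_le_xiMax hη i₀⟩,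
    hscale, iSup₂_le fun ℓ hℓ => ?_, le_iInf₂ fun ℓ hℓ => ?_⟩
  · rw [EReal.div_le_iff_le_mul (AntiDist.natCast_pos_ereal hℓ) (EReal.natCast_ne_top ℓ),
      ← hscale ℓ hℓ]
    exact AntiDist.xiMin_le_errExponent hη0 hη1 (fun i => (hρ i).tensorPow ℓ) i₀
  · rw [EReal.le_div_iff_mul_le (AntiDist.natCast_pos_ereal hℓ) (EReal.natCast_ne_top ℓ),
      mul_comm, ← hscale ℓ hℓ]
    exact AntiDist.errExponent_le_xiMax hη i₀
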